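/- **Notation.** Let $p\ge 3$ and $\mathrm{Sp}(2p;\mathbb Z)=\{M: M^{T}J_0M=J_0\}$, $J_0=\begin{bmatrix}0&\mathrm{Id}\\-\mathrm{Id}&0\end{bmatrix}$, $\omega(v,w)=v^TJ_0w$. Let $\mathcal H=\{\pm[1],\dots,\pm[p]\}\subset\mathbb Z^p$ ($[i]$ the $i$-th unit vector); index the standard basis of $\mathbb R^{2p}$ by $\mathcal H$: $z_{[1]},\dots,z_{[p]},z_{-[1]},\dots,z_{-[p]}$, and let $\mathbb R^S$ be the span of $\{z_s\}_{s\in S}$ for $S\subset\mathcal H$. Call $S\subset\mathcal H$ isotropic if it contains no pair $\pm s$, and $T\subset\mathcal H$ symplectic if $T=-T$. The roots are the nonzero differences $s-t$ with $s,t\in\mathcal H$; for $T$ symplectic, the roots of $\mathrm{Sp}(T)$ are the nonzero differences $t-t'$ with $t,t'\in T$, and $\mathrm{Sp}(T;\mathbb Z)$ is the group of all $M\in\mathrm{Sp}(2p;\mathbb Z)$ that preserve $\mathbb R^T$ and are the identity on $\mathbb R^{\mathcal H\setminus T}$. For vectors $v,w$ let $u(v\otimes w)$ be the matrix $y\mapsto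 y+(w^Ty)v+\omega(v,y)J_0w$. For $x\in\mathbb Z$ the elementary matrices are $e_{s-t}(x)=u(xz_s\otimes z_t)$ for $s\ne\pm t$, and $e_{2s}(x)\colon y\mapsto y+x(z_{-s}^Ty)z_s$; $e_\alpha=e_\alpha(1)$. (For each root a way of writing it as a difference $s-t$ is fixed; another way changes at most the sign of $x$.) Fix a finite symmetric generating set $\Sigma$ of $\mathrm{Sp}(2p;\mathbb Z)$ containing all $e_\alpha$; $\ell$ denotes the length of words in $\Sigma$. **Shortcuts.** For every nonempty isotropic $S$ fix a free abelian group $\mathbb T_S(\mathbb Z)\subset \mathrm{SL}(S;\mathbb Z)$ of rank $\#S-1$ all of whose elements are diagonalizable over $\mathbb R$ with positive eigenvalues (here $\mathrm{SL}(S;\mathbb Z)\subset\mathrm{Sp}(2p;\mathbb Z)$ consists of the matrices that preserve $\mathbb R^{S}$ and $\mathbb R^{-S}$, are the identity on the other basis vectors and have determinant $1$ on $\mathbb R^S$). Let $\mathbb T_S(\mathbb R)$ be generated by the real powers of its elements. Fix an eigenbasis $(v_i)$ of $\mathbb R^S$ for $\mathbb T_S(\mathbb Z)$ and, if $\#S\ge2$,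 elements $d_i\in\mathbb T_S(\mathbb R)$ with $d_iv_i=\exp(1)\,v_i$. A pair $(S,S')$ is compatible with a short root $s-t$ (where $t\neq\pm s$) if $s\in S$, $t\in S'$, $S\cap S'=\emptyset$, $S\cup S'$ is isotropic, $\#S\ge2$ and $\#S'\ge1$. Let then $H_{S,S'}(\mathbb Z)$ be generated by $\mathbb T_S(\mathbb Z)$, $\mathbb T_{S'}(\mathbb Z)$ and the $e_{a-b}$, $a\in S$, $b\in S'$. For $x\in\mathbb Z$ write $xz_s\otimes z_t=\sum x_{ij}v_i\otimes w_j$ in the eigenbases $(v_i)$ of $\mathbb R^S$ and $(w_j)$ of $\mathbb R^{S'}$, and let $\hat u(xz_s\otimes z_t)$ be the concatenation of the words $\hat u(x_{ij}v_i\otimes w_j)$ in real matrices, where $\hat u(rv_i\otimes w_j)$ is the single letter $u(rv_i\otimes w_j)$ if $|r|\le1$, and $d_i^{\log|r|}\,u(\mathrm{sign}(r)v_i\otimes w_j)\,d_i^{-\log|r|}$ otherwise; here $d_i^{\pm\log|r|}$ is written as a product of $\lceil\log|r|\rceil$ equal letters. The shortcut $\hat e_{s-t;S,S'}(x)$ is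 an approximation of $W=\hat u(xz_s\otimes z_t)=W_1\cdots W_n$, that is, a word in $\Sigma$ with letters $\gamma_{i-1}^{-1}\gamma_i$ $(1\le i\le n)$, where $\gamma_0=1$, $\gamma_1,\dots,\gamma_n\in H_{S,S'}(\mathbb Z)$, $\gamma_n=W_1\cdots W_n=e_{s-t}(x)$, and every $\gamma_i^{-1}W_1\cdots W_i$ has entries of absolute value at most $C$, for a constant $C$ fixed in advance ($\Sigma$ and $C$ are large enough that such approximations exist). For every short root $\alpha=s-t$ fix a compatible pair $(S,S')$ and put $\hat e_\alpha(x)=\hat e_{\alpha;S,S'}(x)$. For every long root $2s$ fix $(S,T,t)$ with $s\in S$ isotropic, $t\in T$ symplectic, $S\cap T=\emptyset$, $\#S\ge2$, $\#T\ge2$, and put $$\hat e_{2s}(x)=\bigl[\hat e_{s-t;S,T^{+}}(\varepsilon\lfloor x/2\rfloor),\ \hat e_{s+t;S,T^{-}}(1)\bigr]\;e_{2s}^{\,x-2\lfloor x/2\rfloor},\qquad \varepsilon=\omega(z_s,z_{-s})\,\omega(z_t,z_{-t}),$$ where $T^{+}$ and $T^-$ are the elements of $T$ with the same sign as $t$ and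 as $-t$ respectively. Thus $\hat e_\alpha(x)$ is a word in $\Sigma$ representing $e_\alpha(x)$. **Theorem.** There is a constant $K$, depending only on $p$, $\Sigma$ and the choices of the shortcuts, such that the following holds. Let $T\subset\mathcal H$ be symplectic and let $w$ be a word in $\Sigma$ that represents a matrix $M\in\mathrm{Sp}(T;\mathbb Z)$. Then there are roots $\alpha_1,\dots,\alpha_k$ of $\mathrm{Sp}(T)$ and integers $x_1,\dots,x_k$ with $$e_{\alpha_1}(x_1)\cdots e_{\alpha_k}(x_k)=M\qquad\text{and}\qquad \ell\bigl(\hat e_{\alpha_1}(x_1)\cdots\hat e_{\alpha_k}(x_k)\bigr)\le K\,\ell(w).$$ -/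

import Mathlib

open Matrix

noncomputable section

namespace SpShortcut

/-! ### Half roots, the standard basis, elementary symplectic matrices -/

/-- Half roots: `Sum.inl i` is `[i]` and `Sum.inr i` is `-[i]`. They index the standard basis of
`R^{2p}`, in the block order used by `Matrix.symplecticGroup`. -/
abbrev HalfRoot (p : ℕ) : Type := Fin p ⊕ Fin p

/-- The group `Sp(2p; R)`. (Mathlib's `Matrix.J` is `-J₀`, which defines the same group.) -/
abbrev Sp (p : ℕ) (R : Type) [CommRing R] : Type := Matrix.symplecticGroup (Fin p) R

variable {p : ℕ}

/-- The half root `-s`. -/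
def hneg (s : HalfRoot p) : HalfRoot p := Sum.swap s

/-- `1` on the `[i]` and `-1` on the `-[i]`; this is `ω(z_s, z_{-s})`. -/
def sgn (s : HalfRoot p) : ℤ := Sum.elim (fun _ => 1) (fun _ => -1) s

/-- The half root as a linear functional `±[i]`, in coordinates. -/
def hvec (s : HalfRoot p) : Fin p → ℤ :=
  Sum.elim (fun i => Pi.single i 1) (fun i => -Pi.single i 1) s

/-- A set of half roots is isotropic if it contains no pair `±s`. -/
def IsIsotropic (S : Finset (HalfRoot p)) : Prop := ∀ s ∈ S, hneg s ∉ S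

/-- A set of half roots is symplectic if it is closed under negation. -/
def IsSymplectic (T : Finset (HalfRoot p)) : Prop := ∀ t ∈ T, hneg t ∈ T

/-- The roots of `Sp(T)`: the nonzero differences `t - t'` with `t, t' ∈ T`. -/
def spRoots (T : Finset (HalfRoot p)) : Set (Fin p → ℤ) :=
  {α | α ≠ 0 ∧ ∃ t ∈ T, ∃ t' ∈ T, α = hvec t - hvec t'}

/-- The set `Φ` of all roots. -/
def roots (p : ℕ) : Set (Fin p → ℤ) := spRoots (Finset.univ : Finset (HalfRoot p))

/-- The standard basis vector `z_s`. -/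
def z {R : Type} [CommRing R] (s : HalfRoot p) : HalfRoot p → R := Pi.single s 1

/-- The matrix `J₀` of the symplectic form. -/
def J₀ (p : ℕ) (R : Type) [CommRing R] : Matrix (HalfRoot p) (HalfRoot p) R :=
  Matrix.fromBlocks 0 1 (-1) 0

/-- The nilpotent part `y ↦ (wᵀ y) v + (vᵀ J₀ y) J₀ w` of `u(v ⊗ w)`. -/
def uNil {R : Type} [CommRing R] (v w : HalfRoot p → R) : Matrix (HalfRoot p) (HalfRoot p) R :=
  vecMulVec v w + vecMulVec (J₀ p R *ᵥ w) (v ᵥ* J₀ p R)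

/-- The matrix `u(v ⊗ w)`. -/
def u {R : Type} [CommRing R] (v w : HalfRoot p → R) : Matrix (HalfRoot p) (HalfRoot p) R :=
  1 + uNil v w

/-- The nilpotent part of the elementary matrix `e_{s-t}`; the root `2s` is `s - (-s)`. -/
def elemNil (s t : HalfRoot p) : Matrix (HalfRoot p) (HalfRoot p) ℤ :=
  if t = hneg s then vecMulVec (z s) (z (hneg s)) else uNil (z s) (z t)

theorem J₀_eq (R : Type) [CommRing R] : J₀ p R = -J (Fin p) R := by
  simp [J₀, J, Matrix.fromBlocks_neg]

theorem J₀_transpose (R : Type) [CommRing R] : (J₀ p R)ᵀ = -J₀ p R := by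
  simp [J₀_eq]

theorem J₀_mul_J₀ (R : Type) [CommRing R] : J₀ p R * J₀ p R = -1 := by
  simp [J₀_eq, J_squared]

theorem hneg_ne (s : HalfRoot p) : hneg s ≠ s := by
  rcases s with i | i <;> simp [hneg]

theorem one_add_mem {R : Type} [CommRing R] {N : Matrix (HalfRoot p) (HalfRoot p) R}
    (h : N * J₀ p R + J₀ p R * Nᵀ = 0) (h2 : N * N = 0) :
    1 + N ∈ symplecticGroup (Fin p) R := by
  have hJ : J (Fin p) R = -J₀ p R := by simp [J₀_eq]
  have h' : J₀ p R * Nᵀ = -(N * J₀ p R) := by rw [add_comm] at h; exact eq_neg_of_add_eq_zero_left h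
  rw [SymplecticGroup.mem_iff, hJ, transpose_add, transpose_one]
  have e : (1 + N) * -J₀ p R * (1 + Nᵀ) =
      -J₀ p R - (N * J₀ p R + J₀ p R * Nᵀ) - N * (J₀ p R * Nᵀ) := by noncomm_ring
  rw [e, h, h', Matrix.mul_neg, ← Matrix.mul_assoc, h2]
  simp

theorem uNil_lie {R : Type} [CommRing R] (v w : HalfRoot p → R) :
    uNil v w * J₀ p R + J₀ p R * (uNil v w)ᵀ = 0 := by
  have h1 : ∀ y : HalfRoot p → R, y ᵥ* J₀ p R = -(J₀ p R *ᵥ y) := by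
    intro y
    rw [← mulVec_transpose, J₀_transpose, neg_mulVec]
  simp only [uNil, Matrix.add_mul, transpose_add, Matrix.mul_add, transpose_vecMulVec,
    vecMulVec_mul, mul_vecMulVec, vecMul_vecMul, J₀_mul_J₀]
  simp only [h1, mulVec_neg, mulVec_mulVec, J₀_mul_J₀, neg_mulVec, one_mulVec, vecMul_neg,
    vecMul_one, vecMulVec_neg, neg_neg]
  abel

theorem uNil_sq {R : Type} [CommRing R] {v w : HalfRoot p → R} (h : w ⬝ᵥ v = 0) :
    uNil v w * uNil v w = 0 := by
  have h0 : ∀ y : HalfRoot p → R, y ⬝ᵥ (J₀ p R *ᵥ y) = 0 := by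
    intro y
    simp [J₀, dotProduct, mulVec, Fintype.sum_sum_type, fromBlocks, Matrix.one_apply]
    rw [← sub_eq_add_neg, sub_eq_zero]
    exact Finset.sum_congr rfl fun i _ => mul_comm _ _
  have h3 : (v ᵥ* J₀ p R) ⬝ᵥ v = 0 := by rw [← dotProduct_mulVec]; exact h0 v
  have h4 : (v ᵥ* J₀ p R) ⬝ᵥ (J₀ p R *ᵥ w) = 0 := by
    rw [← dotProduct_mulVec, mulVec_mulVec, J₀_mul_J₀, neg_mulVec, one_mulVec, dotProduct_neg,
      dotProduct_comm, h, neg_zero]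
  simp only [uNil, Matrix.add_mul, Matrix.mul_add, vecMulVec_mul_vecMulVec, h, h0, h3, h4]
  simp

theorem elemNil_mem {s t : HalfRoot p} (h : s ≠ t) (x : ℤ) :
    1 + x • elemNil s t ∈ symplecticGroup (Fin p) ℤ := by
  have key : elemNil s t * J₀ p ℤ + J₀ p ℤ * (elemNil s t)ᵀ = 0 ∧
      elemNil s t * elemNil s t = 0 := by
    unfold elemNil
    split_ifs with ht
    · constructor
      · ext a b
        rcases s with i | i <;> rcases a with a | a <;> rcases b with b | b <;>
          simp [z, hneg, J₀, vecMulVec_mul, mul_vecMulVec, vecMulVec_apply, fromBlocks,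
            Matrix.one_apply, Pi.single_apply] <;>
          grind
      · rw [vecMulVec_mul_vecMulVec]
        simp [z, hneg_ne]
    · exact ⟨uNil_lie _ _, uNil_sq (by simp [z, Ne.symm h])⟩
  apply one_add_mem
  · rw [transpose_smul, Matrix.smul_mul, Matrix.mul_smul, ← smul_add, key.1, smul_zero]
  · rw [Matrix.smul_mul, Matrix.mul_smul, key.2, smul_zero, smul_zero]

/-- The elementary symplectic matrix `e_{s-t}(x) = e_{s-t}^x`, for `s ≠ t`. -/
def elem (s t : HalfRoot p) (x : ℤ) : Sp p ℤ :=
  if h : s ≠ t then ⟨1 + x • elemNil s t, elemNil_mem h x⟩ else 1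

/-! ### Diagonal blocks -/

/-- The span `R^S` of the `z_s` with `s ∈ S`. -/
def coordSpan (R : Type) [CommRing R] (S : Finset (HalfRoot p)) :
    Submodule R (HalfRoot p → R) := Submodule.span R (z '' (S : Set (HalfRoot p)))

/-- The symplectic diagonal block `Sp(T; ℤ)`: the matrices that preserve the span of the `z_t` with
`t ∈ T` and act as the identity on the span of the `z_s` with `s ∉ T`. -/
def spBlock (T : Finset (HalfRoot p)) : Set (Sp p ℤ) :=
  {M | (∀ v ∈ coordSpan ℤ T, (M : Matrix (HalfRoot p) (HalfRoot p) ℤ) *ᵥ v ∈ coordSpan ℤ T) ∧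
    ∀ v ∈ coordSpan ℤ Tᶜ, (M : Matrix (HalfRoot p) (HalfRoot p) ℤ) *ᵥ v = v}

/-- The diagonal block `SL(S; ℤ)`: the matrices that preserve the span of the `z_s` with `s ∈ S` and
the span of the `z_{-s}` with `s ∈ S`, act as the identity on the span of the remaining basis
vectors, and have determinant `1` on the span of the `z_s` with `s ∈ S`. -/
def slBlock (S : Finset (HalfRoot p)) : Set (Sp p ℤ) :=
  {M | (∀ v ∈ coordSpan ℤ S, (M : Matrix (HalfRoot p) (HalfRoot p) ℤ) *ᵥ v ∈ coordSpan ℤ S) ∧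
    (∀ v ∈ coordSpan ℤ (S.image hneg),
      (M : Matrix (HalfRoot p) (HalfRoot p) ℤ) *ᵥ v ∈ coordSpan ℤ (S.image hneg)) ∧
    (∀ v ∈ coordSpan ℤ (S ∪ S.image hneg)ᶜ, (M : Matrix (HalfRoot p) (HalfRoot p) ℤ) *ᵥ v = v) ∧
    ((M : Matrix (HalfRoot p) (HalfRoot p) ℤ).submatrix
      (fun a : S => (a : HalfRoot p)) (fun a : S => (a : HalfRoot p))).det = 1}

/-! ### Tori -/

/-- The real matrix underlying an element of `Sp(2p; ℤ)`. -/
def toReal (g : Sp p ℤ) : Matrix (HalfRoot p) (HalfRoot p) ℝ :=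
  (g : Matrix (HalfRoot p) (HalfRoot p) ℤ).map (Int.cast : ℤ → ℝ)

/-- Diagonalizable over `ℝ` with positive eigenvalues. -/
def IsPosDiagonalizable (g : Matrix (HalfRoot p) (HalfRoot p) ℝ) : Prop :=
  ∃ b : Module.Basis (HalfRoot p) ℝ (HalfRoot p → ℝ), ∀ i, ∃ μ : ℝ, 0 < μ ∧ g *ᵥ b i = μ • b i

/-- `T` may serve as the torus `𝕋_S(ℤ)`: it is a subgroup of `SL(S; ℤ)`, free abelian of rank
`#S - 1`, all of whose elements are diagonalizable with positive eigenvalues. -/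
def IsTorus (S : Finset (HalfRoot p)) (T : Subgroup (Sp p ℤ)) : Prop :=
  (T : Set (Sp p ℤ)) ⊆ slBlock S ∧
  Nonempty (T ≃* Multiplicative (Fin (S.card - 1) → ℤ)) ∧
  ∀ g ∈ T, IsPosDiagonalizable (toReal g)

/-- `h` is the real power `g ^ x` of `g`. If `g` is diagonalizable with positive eigenvalues,
exactly one matrix `h` satisfies this. -/
def IsRealPow (g : Matrix (HalfRoot p) (HalfRoot p) ℝ) (x : ℝ)
    (h : Matrix (HalfRoot p) (HalfRoot p) ℝ) : Prop :=
  ∀ (μ : ℝ) (v : HalfRoot p → ℝ), 0 < μ → g *ᵥ v = μ • v → h *ᵥ v = (μ ^ x) • v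

/-- The group `𝕋_S(ℝ)` generated by the real powers of the elements of `𝕋_S(ℤ)`. -/
def realTorus (T : Subgroup (Sp p ℤ)) : Subgroup (Sp p ℝ) :=
  Subgroup.closure {h | ∃ g ∈ T, ∃ x : ℝ, IsRealPow (toReal g) x h}

/-- A vector of `ℝ^S`, extended by zero. -/
def extend {S : Finset (HalfRoot p)} (f : S → ℝ) : HalfRoot p → ℝ :=
  fun h => if hS : h ∈ S then f ⟨h, hS⟩ else 0

/-! ### Words -/

/-- A finite symmetric generating set of `Sp(2p; ℤ)` that contains the elementary generators. -/
structure IsGeneratingSet (A : Set (Sp p ℤ)) : Prop where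
  finite : A.Finite
  symmetric : ∀ g ∈ A, g⁻¹ ∈ A
  generates : Subgroup.closure A = ⊤
  elem_mem : ∀ s t : HalfRoot p, s ≠ t → elem s t 1 ∈ A

/-- The formal inverse of a word. -/
def invWord {G : Type} [Group G] (w : List G) : List G := (w.map (·⁻¹)).reverse

/-- The commutator `[w, w'] = w w' w⁻¹ w'⁻¹` of two words. -/
def commWord {G : Type} [Group G] (w w' : List G) : List G := w ++ w' ++ invWord w ++ invWord w'

/-- The word for `d ^ y`, where `d x` is the `x`-th power of `d`: it has `⌈|y|⌉` equal letters, each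
of them a power of `d` with exponent in `[-1, 1]`. -/
def powWord (d : ℝ → Sp p ℝ) (y : ℝ) : List (Matrix (HalfRoot p) (HalfRoot p) ℝ) :=
  List.replicate ⌈|y|⌉₊ ((d (y / ⌈|y|⌉₊) : Sp p ℝ) : Matrix (HalfRoot p) (HalfRoot p) ℝ)

/-- The word `û(x v ⊗ w)`, where `d` is a one-parameter group with `d x v = exp x • v`: the letter
`u(x v ⊗ w)` if `|x| ≤ 1`, and `d^(log |x|) u(± v ⊗ w) d^(-log |x|)` otherwise, `±` being the sign
of `x`. -/
def uHat (d : ℝ → Sp p ℝ) (v w : HalfRoot p → ℝ) (x : ℝ) :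
    List (Matrix (HalfRoot p) (HalfRoot p) ℝ) :=
  if |x| ≤ 1 then [u (x • v) w]
  else powWord d (Real.log |x|) ++ [u ((if 0 < x then (1 : ℝ) else -1) • v) w] ++
    powWord d (-Real.log |x|)

/-- The word `w` in the alphabet `A` is an approximation of the word `W = W₁ ⋯ Wₙ` of real matrices
by elements of the subgroup `H` of `Sp(2p; ℤ)`: there are `γ₀ = 1, γ₁, …, γₙ = W₁ ⋯ Wₙ` in `H` such
that all `γᵢ⁻¹ W₁ ⋯ Wᵢ` lie in a fixed bounded set, and `w` has the letters `γᵢ⁻¹ γᵢ₊₁`. -/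
def IsApproximation (A : Set (Sp p ℤ)) (H : Subgroup (Sp p ℤ)) (C : ℝ)
    (W : List (Matrix (HalfRoot p) (HalfRoot p) ℝ)) (w : List (Sp p ℤ)) : Prop :=
  ∃ γ : ℕ → Sp p ℤ, γ 0 = 1 ∧ toReal (γ W.length) = W.prod ∧
    (∀ i ≤ W.length, γ i ∈ H ∧ ∀ a b, |(toReal (γ i)⁻¹ * (W.take i).prod) a b| ≤ C) ∧
    w = (List.range W.length).map (fun i => (γ i)⁻¹ * γ (i + 1)) ∧
    ∀ g ∈ w, g ∈ A

/-! ### Shortcuts -/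

/-- The pair `(S, S')` is compatible with the short root `s - t`. -/
def Compatible (s t : HalfRoot p) (S S' : Finset (HalfRoot p)) : Prop :=
  s ∈ S ∧ t ∈ S' ∧ Disjoint S S' ∧ IsIsotropic (S ∪ S') ∧ 2 ≤ S.card ∧ 1 ≤ S'.card

/-- The triple `(S, T, t)` is compatible with the long root `2s`. -/
def LongCompatible (s : HalfRoot p) (S T : Finset (HalfRoot p)) (t : HalfRoot p) : Prop :=
  s ∈ S ∧ t ∈ T ∧ Disjoint S T ∧ IsIsotropic S ∧ IsSymplectic T ∧ 2 ≤ S.card ∧ 2 ≤ T.card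

/-- The one of the two halves `T⁺`, `T⁻` of `T` that has the same sign as `t`. -/
def sameSign (T : Finset (HalfRoot p)) (t : HalfRoot p) : Finset (HalfRoot p) :=
  T.filter fun h => sgn h = sgn t

/-- A choice of tori `𝕋_S(ℤ)` with, for every isotropic `S`, an eigenbasis `v` of the action on
`ℝ^S` and, if `#S ≥ 2`, elements `dᵢ` of `𝕋_S(ℝ)` with `dᵢ vᵢ = e vᵢ`; `d S i x` is `dᵢ ^ x`. -/
structure TorusData (p : ℕ) where
  torus : Finset (HalfRoot p) → Subgroup (Sp p ℤ)
  isTorus : ∀ S, IsIsotropic S → S.Nonempty → IsTorus S (torus S)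
  v : ∀ S : Finset (HalfRoot p), Module.Basis S ℝ (S → ℝ)
  eigen : ∀ S, IsIsotropic S → ∀ g ∈ torus S, ∀ i : S,
    ∃ μ : ℝ, toReal g *ᵥ extend (v S i) = μ • extend (v S i)
  d : ∀ S : Finset (HalfRoot p), S → ℝ → Sp p ℝ
  d_mem : ∀ S, IsIsotropic S → 2 ≤ S.card → ∀ i : S, d S i 1 ∈ realTorus (torus S)
  d_eigen : ∀ S, IsIsotropic S → 2 ≤ S.card → ∀ i : S,
    (d S i 1 : Matrix (HalfRoot p) (HalfRoot p) ℝ) *ᵥ extend (v S i) =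
      Real.exp 1 • extend (v S i)
  d_pow : ∀ S, IsIsotropic S → 2 ≤ S.card → ∀ (i : S) (x : ℝ),
    IsRealPow (d S i 1 : Matrix (HalfRoot p) (HalfRoot p) ℝ) x (d S i x)

namespace TorusData

/-- The group `H_{S,S'}(ℤ)`, generated by `𝕋_S(ℤ)`, `𝕋_{S'}(ℤ)` and the `e_{s-s'}` with `s ∈ S` and
`s' ∈ S'`. -/
def H (D : TorusData p) (S S' : Finset (HalfRoot p)) : Subgroup (Sp p ℤ) :=
  D.torus S ⊔ D.torus S' ⊔ Subgroup.closure {g | ∃ s ∈ S, ∃ s' ∈ S', g = elem s s' 1}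

/-- The word `û(x z_s ⊗ z_t)`, for `s ∈ S` and `t ∈ S'`: the product of the words
`û(xᵢⱼ vᵢ ⊗ wⱼ)`, where `x z_s ⊗ z_t = ∑ xᵢⱼ vᵢ ⊗ wⱼ` in the chosen bases `v` of `ℝ^S` and `w` of
`ℝ^S'`. -/
def uHatWord (D : TorusData p) (S S' : Finset (HalfRoot p)) (s : S) (t : S') (x : ℤ) :
    List (Matrix (HalfRoot p) (HalfRoot p) ℝ) :=
  (Finset.univ : Finset (S × S')).toList.flatMap fun ij =>
    uHat (D.d S ij.1) (extend (D.v S ij.1)) (extend (D.v S' ij.2))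
      (x * (D.v S).repr (Pi.single s 1) ij.1 * (D.v S').repr (Pi.single t 1) ij.2)

end TorusData

/-- All choices that enter the definition of the shortcuts, with words in the alphabet `A`. -/
structure ShortcutSystem (p : ℕ) (A : Set (Sp p ℤ)) extends TorusData p where
  /-- the bound for the approximations -/
  C : ℝ
  /-- the shortcut `ê_{s-t;S,S'}(x)`, an approximation of `û(x z_s ⊗ z_t)` -/
  short : HalfRoot p → HalfRoot p → Finset (HalfRoot p) → Finset (HalfRoot p) → ℤ → List (Sp p ℤ)
  short_spec : ∀ s t S S' (h : Compatible s t S S') (x : ℤ),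
    IsApproximation A (toTorusData.H S S') C
      (toTorusData.uHatWord S S' ⟨s, h.1⟩ ⟨t, h.2.1⟩ x) (short s t S S' x)
  /-- a way `head α - tail α` of writing the root `α` as a difference of half roots. -/
  head : (Fin p → ℤ) → HalfRoot p
  tail : (Fin p → ℤ) → HalfRoot p
  head_sub_tail : ∀ α ∈ roots p, α = hvec (head α) - hvec (tail α)
  /-- the compatible pair fixed for the short root `α` -/
  S : (Fin p → ℤ) → Finset (HalfRoot p)
  S' : (Fin p → ℤ) → Finset (HalfRoot p)
  compatible : ∀ α ∈ roots p, tail α ≠ hneg (head α) →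
    Compatible (head α) (tail α) (S α) (S' α)
  /-- the compatible triple fixed for the long root `2s` -/
  longS : HalfRoot p → Finset (HalfRoot p)
  longT : HalfRoot p → Finset (HalfRoot p)
  longt : HalfRoot p → HalfRoot p
  longCompatible : ∀ s, LongCompatible s (longS s) (longT s) (longt s)

namespace ShortcutSystem

variable {A : Set (Sp p ℤ)}

/-- The elementary matrix `e_α(x)`. -/
def e (E : ShortcutSystem p A) (α : Fin p → ℤ) (x : ℤ) : Sp p ℤ := elem (E.head α) (E.tail α) x

/-- The shortcut for `e_{2s}(x)` given by the triple `(S, T, t)`: the commutator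
`[ê_{s-t}(±⌊x/2⌋), ê_{s+t}(1)]`, which represents `e_{2s}(2⌊x/2⌋)`, followed by the letter `e_{2s}`
if `x` is odd. -/
def long (E : ShortcutSystem p A) (s : HalfRoot p) (S T : Finset (HalfRoot p)) (t : HalfRoot p)
    (x : ℤ) : List (Sp p ℤ) :=
  commWord (E.short s t S (sameSign T t) (sgn s * sgn t * (x / 2)))
      (E.short s (hneg t) S (sameSign T (hneg t)) 1) ++
    if x % 2 = 1 then [elem s (hneg s) 1] else []

/-- The shortcut `ê_α(x)`, a word representing `e_α(x)`. -/
def shortcut (E : ShortcutSystem p A) (α : Fin p → ℤ) (x : ℤ) : List (Sp p ℤ) :=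
  if E.tail α = hneg (E.head α) then
    E.long (E.head α) (E.longS (E.head α)) (E.longT (E.head α)) (E.longt (E.head α)) x
  else E.short (E.head α) (E.tail α) (E.S α) (E.S' α) x

end ShortcutSystem

end SpShortcut

end

/-!
Only the size of the matrix `M` enters: a word of length `n ≥ 1` in a finite alphabet represents a
matrix of operator norm at most `2 ^ m` with `m = O(n)` (`exists_norm_prod_le`), and a shortcut
`ê_α(x)` has length `O(1 + log |x|)`, since it has as many letters as the word in real matrices that
it approximates (`ShortcutSystem.exists_length_shortcut_le`). So it suffices to factor every
`M ∈ Sp(T; ℤ)` of norm at most `2 ^ m` into elementary matrices `e_α(x)` with roots in `Sp(T)`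
such that the sum of the costs `1 + log |x|` is `O(m)` (`exists_elemCost_of_norm_le`).

This is Gaussian elimination. The Euclidean algorithm on two entries `a`, `b` of a column costs
`O(1 + log |a| + log |b|)`, because the product of the numbers `q + 1`, over the quotients `q`, is
bounded by a polynomial in `a` and `b` (`exists_euclid`). For a fixed `t ∈ T`, it is applied to the
pairs of entries `s`, `-s` of column `t`, which leaves an isotropic set of nonzero entries, and
then to the pairs `t`, `s`, where the short root elements act as in `SL₂` (`reduces_column`). When
column `t` has become `z_t`, row `-t` is that of the identity, and one elementary matrix per entry
clears column `-t`; the result lies in `Sp(T ∖ {±t})` (`reduces_spBlock_erase`), and induction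
on `T` applies. The number of these steps depends on `p` only. The intermediate matrices need no
separate estimate: a product of elementary matrices of cost `c` has norm `2 ^ O(c)`, so a step of
cost `O(m)` turns a matrix of norm `2 ^ m` into one of norm `2 ^ O(m)` (`Reduces.trans`).
-/

namespace SpShortcut

open scoped Matrix.Norms.Operator

variable {p : ℕ}

/-! ### The action of elementary matrices on columns -/


@[simp] theorem hneg_hneg (s : HalfRoot p) : hneg (hneg s) = s := Sum.swap_swap s

theorem hneg_injective : Function.Injective (hneg : HalfRoot p → HalfRoot p) :=
  Function.LeftInverse.injective hneg_hneg

theorem hneg_eq_iff {s t : HalfRoot p} : hneg s = t ↔ s = hneg t :=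
  ⟨fun h => by rw [← h, hneg_hneg], fun h => by rw [h, hneg_hneg]⟩

theorem sgn_mul_self (s : HalfRoot p) : sgn s * sgn s = 1 := by
  rcases s with i | i <;> simp [sgn]

theorem sgn_hneg (s : HalfRoot p) : sgn (hneg s) = -sgn s := by
  rcases s with i | i <;> simp [sgn, hneg]

theorem J₀_mulVec_z (t : HalfRoot p) : J₀ p ℤ *ᵥ z t = -sgn t • z (hneg t) := by
  ext a
  rcases t with i | i <;> rcases a with a | a <;>
    simp [z, J₀, sgn, hneg, Matrix.one_apply, Pi.single_apply]
  grind

theorem z_vecMul_J₀ (s : HalfRoot p) : z s ᵥ* J₀ p ℤ = sgn s • z (hneg s) := by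
  ext a
  rcases s with i | i <;> rcases a with a | a <;>
    simp [z, J₀, sgn, hneg, Matrix.one_apply, Pi.single_apply] <;> grind

theorem elemNil_eq {s t : HalfRoot p} : elemNil s t = vecMulVec (z s) (z t) +
    if t = hneg s then 0 else (-(sgn s * sgn t)) • vecMulVec (z (hneg t)) (z (hneg s)) := by
  unfold elemNil
  split_ifs with h
  · rw [h, add_zero]
  · rw [uNil, J₀_mulVec_z, z_vecMul_J₀, smul_vecMulVec, vecMulVec_smul, smul_smul]
    congr 2
    ring

theorem coe_elem {s t : HalfRoot p} (h : s ≠ t) (x : ℤ) :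
    (elem s t x).1 = 1 + x • elemNil s t := by
  rw [elem, dif_pos h]

/-- Left multiplication by `e_{s-t}(x)` adds `x` times row `t` to row `s` and, unless `t = -s`,
adds a multiple of row `-s` to row `-t`. -/
theorem elem_mul_apply {s t : HalfRoot p} (h : s ≠ t) (x : ℤ) (M : Sp p ℤ) (a b : HalfRoot p) :
    (elem s t x * M).1 a b = M.1 a b + (if a = s then x * M.1 t b else 0) +
      if t ≠ hneg s ∧ a = hneg t then -(sgn s * sgn t * x) * M.1 (hneg s) b else 0 := by
  have hz : ∀ c d : HalfRoot p,
      (vecMulVec (z c) (z d) * M.1 : Matrix (HalfRoot p) (HalfRoot p) ℤ) a b =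
        if a = c then M.1 d b else 0 := by
    intro c d
    rw [vecMulVec_mul, vecMulVec_apply]
    simp [z, Pi.single_apply]
  rw [Submonoid.coe_mul, coe_elem h, elemNil_eq, Matrix.add_mul, Matrix.one_mul, Matrix.smul_mul,
    Matrix.add_mul, Matrix.add_apply, Matrix.smul_apply, Matrix.add_apply, hz]
  by_cases h1 : t = hneg s
  · rw [if_pos h1, Matrix.zero_mul]
    simp [h1]
  · rw [if_neg h1, Matrix.smul_mul, Matrix.smul_apply, hz]
    simp only [smul_eq_mul, ne_eq, h1, not_false_eq_true, true_and]
    split_ifs <;> ring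

theorem elem_mul_elem_self {s t : HalfRoot p} (h : s ≠ t) (x y : ℤ) :
    elem s t x * elem s t y = elem s t (x + y) := by
  have hs : t ≠ s := h.symm
  have h1 : s ≠ hneg s := (hneg_ne s).symm
  have h2 : t ≠ hneg t := (hneg_ne t).symm
  have h3 : hneg s ≠ hneg t := fun e => h (hneg_injective e)
  apply Subtype.ext
  ext a b
  have key := fun w => elem_mul_apply h w (1 : Sp p ℤ)
  simp only [mul_one] at key
  rw [elem_mul_apply h, key y a, key y t, key y (hneg s), key (x + y)]
  simp only [hs, h2, h3, h1.symm, if_false, and_false]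
  split_ifs <;> ring

theorem elem_zero (s t : HalfRoot p) : elem s t 0 = 1 := by
  apply Subtype.ext
  simp only [elem]
  split_ifs <;> simp

theorem inv_elem {s t : HalfRoot p} (h : s ≠ t) (x : ℤ) : (elem s t x)⁻¹ = elem s t (-x) :=
  inv_eq_of_mul_eq_one_right (by rw [elem_mul_elem_self h, add_neg_cancel, elem_zero])

/-- The two ways `s - t` and `-t - (-s)` of writing a short root give the same elementary matrices
up to the sign of the argument. -/
theorem elem_hneg_hneg {s t : HalfRoot p} (h : t ≠ hneg s) (x : ℤ) :
    elem (hneg t) (hneg s) (-(sgn s * sgn t * x)) = elem s t x := by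
  by_cases hst : s = t
  · subst hst
    simp [elem]
  have h1 : hneg t ≠ hneg s := fun e => hst (hneg_injective e).symm
  have h2 : hneg s ≠ t := h.symm
  have e1 := sgn_mul_self s
  have e2 := sgn_mul_self t
  rw [elem, dif_pos h1, elem, dif_pos hst]
  apply Subtype.ext
  simp only [elemNil_eq, hneg_hneg, sgn_hneg, if_neg h, if_neg h2, smul_add, smul_smul]
  rw [add_comm (_ • _)]
  congr 3
  · linear_combination x * sgn s * sgn s * e2 + x * e1
  · ring

/-! ### Diagonal blocks in coordinates -/

theorem mem_coordSpan_iff {S : Finset (HalfRoot p)} {v : HalfRoot p → ℤ} :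
    v ∈ coordSpan ℤ S ↔ ∀ a ∉ S, v a = 0 := by
  constructor
  · intro hv a ha
    induction hv using Submodule.span_induction with
    | mem x hx =>
      obtain ⟨s, hs, rfl⟩ := hx
      have : a ≠ s := fun e => ha (e ▸ hs)
      simp [z, this]
    | zero => rfl
    | add x y _ _ h1 h2 => simp [h1, h2]
    | smul c x _ h1 => simp [h1]
  · intro h
    have e : v = ∑ a, v a • z a := by
      ext b
      simp [z, Pi.single_apply]
    rw [e]
    refine Submodule.sum_mem _ fun a _ => ?_
    by_cases ha : a ∈ S
    · exact Submodule.smul_mem _ _ (Submodule.subset_span ⟨a, ha, rfl⟩)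
    · simp [h a ha]

theorem mem_spBlock_iff {T : Finset (HalfRoot p)} {M : Sp p ℤ} : M ∈ spBlock T ↔
    (∀ b ∈ T, ∀ a ∉ T, M.1 a b = 0) ∧
      ∀ b ∉ T, ∀ a, M.1 a b = (1 : Matrix (HalfRoot p) (HalfRoot p) ℤ) a b := by
  have hz : ∀ b, M.1 *ᵥ z b = M.1.col b := fun b => by simp [z]
  constructor
  · rintro ⟨h1, h2⟩
    refine ⟨fun b hb a ha => ?_, fun b hb a => ?_⟩
    · have := h1 (z b) (Submodule.subset_span ⟨b, hb, rfl⟩)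
      rw [hz, mem_coordSpan_iff] at this
      exact this a ha
    · have := congrFun (h2 (z b) (Submodule.subset_span ⟨b, by simpa using hb, rfl⟩)) a
      rw [hz] at this
      simpa [z, Matrix.one_apply, Pi.single_apply] using this
  · rintro ⟨h1, h2⟩
    refine ⟨fun v hv => ?_, fun v hv => ?_⟩
    · rw [mem_coordSpan_iff] at hv ⊢
      intro a ha
      rw [mulVec, dotProduct]
      refine Finset.sum_eq_zero fun b _ => ?_
      by_cases hb : b ∈ T
      · simp [h1 b hb a ha]
      · simp [hv b hb]
    · rw [mem_coordSpan_iff] at hv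
      ext a
      have : (M.1 *ᵥ v) a = ((1 : Matrix (HalfRoot p) (HalfRoot p) ℤ) *ᵥ v) a := by
        rw [mulVec, mulVec, dotProduct, dotProduct]
        refine Finset.sum_congr rfl fun b _ => ?_
        by_cases hb : b ∈ T
        · simp [hv b (by simpa using hb)]
        · simp only [h2 b hb a]
      rw [this, one_mulVec]

theorem one_mem_spBlock (T : Finset (HalfRoot p)) : (1 : Sp p ℤ) ∈ spBlock T := by
  rw [spBlock]
  simp

theorem mul_mem_spBlock {T : Finset (HalfRoot p)} {g h : Sp p ℤ} (hg : g ∈ spBlock T)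
    (hh : h ∈ spBlock T) : g * h ∈ spBlock T := by
  refine ⟨fun v hv => ?_, fun v hv => ?_⟩
  · rw [Submonoid.coe_mul, ← mulVec_mulVec]
    exact hg.1 _ (hh.1 v hv)
  · rw [Submonoid.coe_mul, ← mulVec_mulVec, hh.2 v hv, hg.2 v hv]

theorem elem_mem_spBlock {T : Finset (HalfRoot p)} (hT : IsSymplectic T) {s t : HalfRoot p}
    (hs : s ∈ T) (ht : t ∈ T) (h : s ≠ t) (x : ℤ) : elem s t x ∈ spBlock T := by
  have key := fun a b => elem_mul_apply h x (1 : Sp p ℤ) a b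
  simp only [mul_one] at key
  have hs' := hT s hs
  have ht' := hT t ht
  rw [mem_spBlock_iff]
  refine ⟨fun b hb a ha => ?_, fun b hb a => ?_⟩
  · have h1 : a ≠ b := fun e => ha (e ▸ hb)
    have h2 : a ≠ s := fun e => ha (e ▸ hs)
    have h3 : a ≠ hneg t := fun e => ha (e ▸ ht')
    simp [key, h1, h2, h3]
  · have h1 : t ≠ b := fun e => hb (e ▸ ht)
    have h2 : hneg s ≠ b := fun e => hb (e ▸ hs')
    simp [key, h1, h2]

/-- Rows of a symplectic matrix dual to a fixed column: if `M z_t = z_t`, then the row of `M` with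
index `-t` is that of the identity matrix, because `ω(z_t, M y) = ω(M z_t, M y) = ω(z_t, y)`. -/
theorem row_hneg_of_col {M : Sp p ℤ} {t : HalfRoot p}
    (h : ∀ a, M.1 a t = (1 : Matrix (HalfRoot p) (HalfRoot p) ℤ) a t) (b : HalfRoot p) :
    M.1 (hneg t) b = (1 : Matrix (HalfRoot p) (HalfRoot p) ℤ) (hneg t) b := by
  have hM : M.1ᵀ * J₀ p ℤ * M.1 = J₀ p ℤ := by
    have := SymplecticGroup.mem_iff'.1 M.2
    rw [J₀_eq, Matrix.mul_neg, Matrix.neg_mul, this]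
  have hc : M.1 *ᵥ z t = z t := by
    ext a
    simpa [z, Matrix.one_apply, Pi.single_apply] using h a
  have h1 : z t ᵥ* (M.1ᵀ * J₀ p ℤ * M.1) = (z t ᵥ* J₀ p ℤ) ᵥ* M.1 := by
    rw [← vecMul_vecMul, ← vecMul_vecMul, vecMul_transpose, hc]
  rw [hM, z_vecMul_J₀] at h1
  have h2 := congrFun h1 b
  have e : (z (hneg t) ᵥ* M.1) b = M.1 (hneg t) b := by simp [z]
  rw [smul_vecMul, Pi.smul_apply, Pi.smul_apply, e] at h2
  have h3 := mul_left_cancel₀ (fun e => by simpa [e] using sgn_mul_self t) h2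
  rw [← h3]
  simp [z, Matrix.one_apply, Pi.single_apply, eq_comm]

/-! ### The cost of a factorization into elementary matrices -/

/-- The cost of the factor `e_α(x)`, comparable to `1 + log |x|` (recall `Nat.log 2 0 = 0`). -/
def cost (x : ℤ) : ℕ := 1 + Nat.log 2 x.natAbs

theorem cost_neg (x : ℤ) : cost (-x) = cost x := by simp [cost]

theorem one_le_cost (x : ℤ) : 1 ≤ cost x := by simp [cost]

theorem one_add_natAbs_le_two_pow_cost (x : ℤ) : 1 + x.natAbs ≤ 2 ^ cost x := by
  have := Nat.lt_pow_succ_log_self (b := 2) (by norm_num) x.natAbs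
  rw [cost, add_comm 1 (Nat.log _ _)]
  omega

/-- `ElemCost T g c` says that `g` is a product of elementary matrices `e_{s-t}(x)` with `s, t ∈ T`
whose costs add up to at most `c`. -/
inductive ElemCost (T : Finset (HalfRoot p)) : Sp p ℤ → ℕ → Prop
  | one : ElemCost T 1 0
  | elem {s t : HalfRoot p} (hs : s ∈ T) (ht : t ∈ T) (h : s ≠ t) (x : ℤ) :
      ElemCost T (elem s t x) (cost x)
  | mul {g h : Sp p ℤ} {c d : ℕ} (hg : ElemCost T g c) (hh : ElemCost T h d) :
      ElemCost T (g * h) (c + d)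
  | mono {g : Sp p ℤ} {c d : ℕ} (hg : ElemCost T g c) (hcd : c ≤ d) : ElemCost T g d

namespace ElemCost

variable {T : Finset (HalfRoot p)} {g : Sp p ℤ} {c : ℕ}

theorem subset {T' : Finset (HalfRoot p)} (hT : T' ⊆ T) (h : ElemCost T' g c) :
    ElemCost T g c := by
  induction h with
  | one => exact .one
  | elem hs ht h x => exact .elem (hT hs) (hT ht) h x
  | mul _ _ h1 h2 => exact .mul h1 h2
  | mono _ hcd h1 => exact .mono h1 hcd

theorem inv (h : ElemCost T g c) : ElemCost T g⁻¹ c := by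
  induction h with
  | one => rw [inv_one]; exact .one
  | elem hs ht h x =>
    rw [inv_elem h, ← cost_neg]
    exact .elem hs ht h _
  | mul _ _ h1 h2 =>
    rw [_root_.mul_inv_rev]
    exact (h2.mul h1).mono (by omega)
  | mono _ hcd h1 => exact h1.mono hcd

theorem mem_spBlock (hT : IsSymplectic T) (h : ElemCost T g c) : g ∈ spBlock T := by
  induction h with
  | one => exact one_mem_spBlock T
  | elem hs ht h x => exact elem_mem_spBlock hT hs ht h x
  | mul _ _ h1 h2 => exact mul_mem_spBlock h1 h2
  | mono _ _ h1 => exact h1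

end ElemCost

theorem norm_one_le : ‖(1 : Matrix (HalfRoot p) (HalfRoot p) ℤ)‖ ≤ 1 := by
  rcases isEmpty_or_nonempty (HalfRoot p) with h | h
  · rw [Subsingleton.elim (1 : Matrix (HalfRoot p) (HalfRoot p) ℤ) 0, norm_zero]
    exact zero_le_one
  · rw [norm_one]

theorem natAbs_apply_le_norm (M : Matrix (HalfRoot p) (HalfRoot p) ℤ) (a b : HalfRoot p) :
    ((M a b).natAbs : ℝ) ≤ ‖M‖ := by
  have h1 : ‖M a b‖₊ ≤ ‖M‖₊ := by
    rw [linfty_opNNNorm_def]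
    refine le_trans ?_ (Finset.le_sup (f := fun i => ∑ j, ‖M i j‖₊) (Finset.mem_univ a))
    exact Finset.single_le_sum (f := fun j => ‖M a j‖₊) (fun _ _ => zero_le) (Finset.mem_univ b)
  have h2 : ‖M a b‖ ≤ ‖M‖ := h1
  rwa [Int.norm_eq_abs, ← Int.cast_abs, Int.abs_eq_natAbs, Int.cast_natCast] at h2

/-- The norm of a matrix is at most exponential in the cost of a factorization. -/
theorem exists_norm_le_of_elemCost (p : ℕ) : ∃ β : ℕ, ∀ (T : Finset (HalfRoot p)) (g : Sp p ℤ)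
    (c : ℕ), ElemCost T g c → ‖g.1‖ ≤ 2 ^ (β * c) := by
  obtain ⟨R, hR⟩ : ∃ R : ℕ, ∀ st : HalfRoot p × HalfRoot p, ‖elemNil st.1 st.2‖ ≤ R := by
    obtain ⟨R, hR⟩ := Finite.exists_le fun st : HalfRoot p × HalfRoot p => ‖elemNil st.1 st.2‖
    obtain ⟨n, hn⟩ := exists_nat_ge R
    exact ⟨n, fun st => (hR st).trans hn⟩
  refine ⟨R + 1, fun T g c h => ?_⟩
  induction h with
  | one => simpa using norm_one_le
  | @elem s t hs ht h x =>
    have e1 : ‖x • elemNil s t‖ ≤ x.natAbs * R := by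
      refine (norm_zsmul_le x _).trans ?_
      rw [Int.norm_eq_abs, ← Int.cast_abs, Int.abs_eq_natAbs, Int.cast_natCast]
      exact mul_le_mul_of_nonneg_left (hR (s, t)) (Nat.cast_nonneg _)
    have e2 : (1 + x.natAbs : ℝ) ≤ 2 ^ cost x := by
      exact_mod_cast one_add_natAbs_le_two_pow_cost x
    have e3 : (1 + R : ℝ) ≤ 2 ^ (R * cost x) := by
      have h1 : R + 1 ≤ 2 ^ R := Nat.lt_two_pow_self
      have h2 : 2 ^ R ≤ 2 ^ (R * cost x) :=
        Nat.pow_le_pow_right (by norm_num) (Nat.le_mul_of_pos_right _ (one_le_cost x))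
      have : 1 + R ≤ 2 ^ (R * cost x) := by omega
      exact_mod_cast this
    rw [coe_elem h]
    calc ‖1 + x • elemNil s t‖ ≤ 1 + x.natAbs * R :=
          (norm_add_le _ _).trans (add_le_add norm_one_le e1)
      _ ≤ (1 + R) * (1 + x.natAbs) := by
          have : (0 : ℝ) ≤ R := R.cast_nonneg
          have : (0 : ℝ) ≤ x.natAbs := Nat.cast_nonneg _
          nlinarith
      _ ≤ 2 ^ (R * cost x) * 2 ^ cost x := by gcongr
      _ = 2 ^ ((R + 1) * cost x) := by rw [← pow_add, add_one_mul]
  | mul _ _ h1 h2 =>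
    rw [mul_add, pow_add, Submonoid.coe_mul]
    exact (norm_mul_le _ _).trans (mul_le_mul h1 h2 (norm_nonneg _) (by positivity))
  | mono _ hcd h1 =>
    exact h1.trans (pow_le_pow_right₀ (by norm_num) (Nat.mul_le_mul_left _ hcd))

/-! ### Euclidean algorithm on two entries of a column -/

/-- The Euclidean algorithm on the entries `s` and `t` of a column, when `e_{s-t}` and `e_{t-s}`
act on that column as the elementary matrices of `SL₂`. The quotient `q` of a step `A = q B + r`
costs `1 + log₂ q`, and `A + 1 ≥ (q + 1) (r + 1)` makes the product of the quotients, hence also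
the total cost, controlled by the initial entries. -/
theorem exists_euclid (T : Finset (HalfRoot p)) (n : ℕ) {s t b : HalfRoot p} (hs : s ∈ T)
    (ht : t ∈ T) (hst : s ≠ t) (M : Sp p ℤ)
    (h0 : t = hneg s ∨ M.1 (hneg s) b = 0 ∧ M.1 (hneg t) b = 0)
    (hle : (M.1 t b).natAbs ≤ (M.1 s b).natAbs) (hn : (M.1 t b).natAbs ≤ n) :
    ∃ g c, ElemCost T g c ∧
      2 ^ c ≤ (((M.1 s b).natAbs + 1) * ((M.1 t b).natAbs + 1)) ^ 2 ∧
      ((g * M).1 s b = 0 ∨ (g * M).1 t b = 0) ∧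
      ∀ a, a ≠ s → a ≠ t → (g * M).1 a b = M.1 a b := by
  induction n using Nat.strong_induction_on generalizing s t M with
  | _ n ih =>
  by_cases hz : M.1 t b = 0
  · exact ⟨1, 0, .one, Nat.one_le_iff_ne_zero.2 (by positivity), Or.inr (by simpa using hz),
      by simp⟩
  set q := (M.1 s b).tdiv (M.1 t b) with hq
  set N := elem s t (-q) * M with hN
  have hNs : N.1 s b = (M.1 s b).tmod (M.1 t b) := by
    have h1 : ¬ (t ≠ hneg s ∧ s = hneg t) := fun h => h.1 (by rw [h.2, hneg_hneg])
    have h2 := Int.mul_tdiv_add_tmod (M.1 s b) (M.1 t b)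
    rw [hN, elem_mul_apply hst, if_pos rfl, if_neg h1]
    rw [← hq] at h2
    linear_combination -h2
  have hNa : ∀ a, a ≠ s → N.1 a b = M.1 a b := by
    intro a ha
    rw [hN, elem_mul_apply hst, if_neg ha]
    rcases h0 with h0 | h0
    · simp [h0]
    · simp [h0.1]
  have hNt := hNa t hst.symm
  have hlt : (N.1 s b).natAbs < (M.1 t b).natAbs := by
    rw [hNs, Int.natAbs_tmod]
    exact Nat.mod_lt _ (Int.natAbs_pos.2 hz)
  have h0' : s = hneg t ∨ N.1 (hneg t) b = 0 ∧ N.1 (hneg s) b = 0 := by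
    rcases h0 with h0 | h0
    · exact Or.inl (by rw [h0, hneg_hneg])
    · by_cases h : hneg t = s
      · exact Or.inl h.symm
      · rw [hNa _ h, hNa _ (hneg_ne s)]
        exact Or.inr ⟨h0.2, h0.1⟩
  obtain ⟨g, c, hg, hc, hzero, hother⟩ := ih _ (lt_of_lt_of_le hlt hn) ht hs hst.symm N h0'
    (by rw [hNt]; exact hlt.le) le_rfl
  refine ⟨g * elem s t (-q), c + cost (-q), hg.mul (.elem hs ht hst _), ?_, ?_, ?_⟩
  · rw [hNt] at hc
    have hqv : q.natAbs = (M.1 s b).natAbs / (M.1 t b).natAbs := Int.natAbs_tdiv _ _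
    have hr : (N.1 s b).natAbs = (M.1 s b).natAbs % (M.1 t b).natAbs := by
      rw [hNs, Int.natAbs_tmod]
    generalize (N.1 s b).natAbs = r at *
    generalize (M.1 s b).natAbs = A at *
    generalize (M.1 t b).natAbs = B at *
    have hdm : B * q.natAbs + r = A := by
      rw [hqv, hr]
      exact Nat.div_add_mod A B
    have hq1 : q.natAbs ≠ 0 := by
      rw [hqv]
      exact (Nat.div_pos hle (by omega)).ne'
    have hcost : 2 ^ cost (-q) ≤ 2 * q.natAbs := by
      rw [cost_neg, cost, pow_add, pow_one]
      exact Nat.mul_le_mul_left 2 (Nat.pow_log_le_self 2 hq1)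
    generalize q.natAbs = k at *
    have hA : (k + 1) * (r + 1) ≤ A + 1 := by nlinarith
    calc 2 ^ (c + cost (-q)) ≤ ((B + 1) * (r + 1)) ^ 2 * (2 * k) := by
          rw [pow_add]
          exact Nat.mul_le_mul hc hcost
      _ ≤ ((B + 1) * (r + 1)) ^ 2 * (k + 1) ^ 2 := Nat.mul_le_mul_left _ (by nlinarith)
      _ = ((k + 1) * (r + 1) * (B + 1)) ^ 2 := by ring
      _ ≤ ((A + 1) * (B + 1)) ^ 2 := Nat.pow_le_pow_left (Nat.mul_le_mul_right _ hA) 2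
  · rw [mul_assoc]
    exact hzero.symm
  · intro a h1 h2
    rw [mul_assoc, hother a h2 h1, hNa a h1]

/-! ### Reductions of linear cost -/

/-- Every matrix with property `P` and norm at most `2 ^ m` can be multiplied on the left by a
product of elementary matrices with roots in `Sp(T)`, of cost linear in `m`, to get a matrix with
property `Q`. -/
def Reduces (T : Finset (HalfRoot p)) (P Q : Sp p ℤ → Prop) : Prop :=
  ∃ K : ℕ, ∀ m, 1 ≤ m → ∀ M : Sp p ℤ, P M → ‖M.1‖ ≤ 2 ^ m →
    ∃ g, ElemCost T g (K * m) ∧ Q (g * M)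

namespace Reduces

variable {T : Finset (HalfRoot p)} {P Q R : Sp p ℤ → Prop}

theorem of_imp (h : ∀ M, P M → Q M) : Reduces T P Q :=
  ⟨0, fun m _ M hM _ => ⟨1, ElemCost.one.mono (Nat.zero_le _), by simpa using h M hM⟩⟩

theorem subset {T' : Finset (HalfRoot p)} (hT : T' ⊆ T) (h : Reduces T' P Q) : Reduces T P Q := by
  obtain ⟨K, hK⟩ := h
  refine ⟨K, fun m hm M hM hn => ?_⟩
  obtain ⟨g, hg, hq⟩ := hK m hm M hM hn
  exact ⟨g, hg.subset hT, hq⟩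

theorem trans (h1 : Reduces T P Q) (h2 : Reduces T Q R) : Reduces T P R := by
  obtain ⟨K, hK⟩ := h1
  obtain ⟨K', hK'⟩ := h2
  obtain ⟨β, hβ⟩ := exists_norm_le_of_elemCost p
  refine ⟨K' * (β * K + 1) + K, fun m hm M hM hn => ?_⟩
  obtain ⟨g, hg, hq⟩ := hK m hm M hM hn
  have hn' : ‖(g * M).1‖ ≤ 2 ^ ((β * K + 1) * m) := by
    have e : (2 : ℝ) ^ ((β * K + 1) * m) = 2 ^ (β * (K * m)) * 2 ^ m := by
      rw [← pow_add]
      ring_nf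
    rw [Submonoid.coe_mul, e]
    exact (norm_mul_le _ _).trans (mul_le_mul (hβ _ _ _ hg) hn (norm_nonneg _) (by positivity))
  obtain ⟨g', hg', hr⟩ := hK' _ (hm.trans (Nat.le_mul_of_pos_left m (by omega))) _ hq hn'
  refine ⟨g' * g, (hg'.mul hg).mono (le_of_eq (by ring)), ?_⟩
  rwa [mul_assoc]

/-- Achieve the conditions `Z s` one after the other for all `s` in a finite set `U`. -/
theorem forall_mem {U : Finset (HalfRoot p)} (Z : HalfRoot p → Sp p ℤ → Prop)
    (h : ∀ V ⊆ U, ∀ s ∈ U, Reduces T (fun M => P M ∧ ∀ a ∈ V, Z a M)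
      (fun M => (P M ∧ ∀ a ∈ V, Z a M) ∧ Z s M)) :
    Reduces T P (fun M => P M ∧ ∀ a ∈ U, Z a M) := by
  suffices H : ∀ V ⊆ U, Reduces T P (fun M => P M ∧ ∀ a ∈ V, Z a M) from H U subset_rfl
  intro V
  induction V using Finset.induction_on with
  | empty => exact fun _ => of_imp fun M hM => ⟨hM, by simp⟩
  | insert s V _ ih =>
    intro hV
    have h1 : V ⊆ U := (Finset.subset_insert s V).trans hV
    refine (ih h1).trans ((h V h1 s (hV (Finset.mem_insert_self s V))).trans (of_imp ?_))
    rintro M ⟨⟨h2, h3⟩, h4⟩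
    refine ⟨h2, fun a ha => ?_⟩
    rcases Finset.mem_insert.1 ha with rfl | ha
    · exact h4
    · exact h3 a ha

/-- A reduction by one elementary matrix whose argument is bounded by the norm. -/
theorem elem {s t : HalfRoot p} (hs : s ∈ T) (ht : t ∈ T) (hst : s ≠ t) (x : Sp p ℤ → ℤ)
    (hx : ∀ M : Sp p ℤ, ((x M).natAbs : ℝ) ≤ ‖M.1‖ + 2)
    (h : ∀ M, P M → Q (SpShortcut.elem s t (x M) * M)) : Reduces T P Q := by
  refine ⟨4, fun m hm M hM hn => ⟨_, (ElemCost.elem hs ht hst (x M)).mono ?_, h M hM⟩⟩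
  have h1 : ((x M).natAbs : ℝ) ≤ 2 ^ (m + 2) := by
    have : (1 : ℝ) ≤ 2 ^ m := one_le_pow₀ (by norm_num)
    have e : (2 : ℝ) ^ (m + 2) = 2 ^ m * 4 := by rw [pow_add]; norm_num
    have := hx M
    rw [e]
    linarith
  have h2 : (x M).natAbs ≤ 2 ^ (m + 2) := by exact_mod_cast h1
  have h3 := Nat.log_mono_right (b := 2) h2
  rw [Nat.log_pow (by norm_num)] at h3
  rw [cost]
  omega

end Reduces

theorem reduces_euclid {T : Finset (HalfRoot p)} {P Q : Sp p ℤ → Prop} {s t b : HalfRoot p}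
    (hT : IsSymplectic T) (hs : s ∈ T) (ht : t ∈ T) (hst : s ≠ t)
    (h0 : ∀ M : Sp p ℤ, P M → t = hneg s ∨ M.1 (hneg s) b = 0 ∧ M.1 (hneg t) b = 0)
    (h : ∀ M g : Sp p ℤ, P M → g ∈ spBlock T → (g * M).1 t b = 0 →
      (∀ a, a ≠ s → a ≠ t → (g * M).1 a b = M.1 a b) → Q (g * M)) :
    Reduces T P Q := by
  refine ⟨10, fun m hm M hM hn => ?_⟩
  have hb : ∀ a, (M.1 a b).natAbs + 1 ≤ 2 ^ (m + 1) := by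
    intro a
    have h1 : (M.1 a b).natAbs ≤ 2 ^ m := by
      exact_mod_cast (natAbs_apply_le_norm M.1 a b).trans hn
    have : 1 ≤ 2 ^ m := Nat.one_le_two_pow
    rw [pow_succ]
    omega
  have h0' : s = hneg t ∨ M.1 (hneg t) b = 0 ∧ M.1 (hneg s) b = 0 := by
    rcases h0 M hM with h0 | h0
    · exact Or.inl (by rw [h0, hneg_hneg])
    · exact Or.inr h0.symm
  obtain ⟨g, c, hg, hc, hz, ha⟩ : ∃ g c, ElemCost T g c ∧
      2 ^ c ≤ (((M.1 s b).natAbs + 1) * ((M.1 t b).natAbs + 1)) ^ 2 ∧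
      ((g * M).1 s b = 0 ∨ (g * M).1 t b = 0) ∧
      ∀ a, a ≠ s → a ≠ t → (g * M).1 a b = M.1 a b := by
    rcases le_total (M.1 t b).natAbs (M.1 s b).natAbs with hle | hle
    · exact exists_euclid T _ hs ht hst M (h0 M hM) hle le_rfl
    · obtain ⟨g, c, hg, hc, hz, ha⟩ := exists_euclid T _ ht hs hst.symm M h0' hle le_rfl
      exact ⟨g, c, hg, by rwa [mul_comm (_ + 1)], hz.symm, fun a h1 h2 => ha a h2 h1⟩
  have hcm : c ≤ 4 * (m + 1) := by
    have : 2 ^ c ≤ 2 ^ (4 * (m + 1)) := by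
      refine hc.trans ((Nat.pow_le_pow_left (Nat.mul_le_mul (hb s) (hb t)) 2).trans (le_of_eq ?_))
      rw [← pow_add, ← pow_mul]
      ring_nf
    exact (Nat.pow_le_pow_iff_right (by norm_num)).1 this
  by_cases hzt : (g * M).1 t b = 0
  · exact ⟨g, hg.mono (by omega), h M g hM (hg.mem_spBlock hT) hzt ha⟩
  -- The surviving entry is at `t`: add it to the entry `s` and subtract that again.
  have hzs := hz.resolve_right hzt
  set N := g * M with hN
  have hN0 : t = hneg s ∨ N.1 (hneg s) b = 0 ∧ N.1 (hneg t) b = 0 := by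
    rcases h0 M hM with h0 | h0
    · exact Or.inl h0
    · by_cases e : t = hneg s
      · exact Or.inl e
      · have e' : hneg t ≠ s := fun e' => e (by rw [← e', hneg_hneg])
        rw [ha _ (hneg_ne s) (Ne.symm e), ha _ e' (hneg_ne t)]
        exact Or.inr h0
  have hN1 : ∀ a, (SpShortcut.elem s t 1 * N).1 a b = N.1 a b + if a = s then N.1 t b else 0 := by
    intro a
    rw [elem_mul_apply hst, one_mul]
    rcases hN0 with e | e
    · simp [e]
    · simp [e.1]
  have hN2 : ∀ a, (SpShortcut.elem t s (-1) * (SpShortcut.elem s t 1 * N)).1 a b =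
      N.1 a b + (if a = s then N.1 t b else 0) - if a = t then N.1 t b else 0 := by
    intro a
    rw [elem_mul_apply hst.symm, hN1, hN1, hN1, if_pos rfl, hzs]
    rcases hN0 with e | e
    · rw [if_neg (fun h : s ≠ hneg t ∧ a = hneg s => h.1 (by rw [e, hneg_hneg]))]
      split_ifs <;> ring
    · by_cases e' : hneg t = s
      · rw [if_neg (fun h : s ≠ hneg t ∧ a = hneg s => h.1 e'.symm)]
        split_ifs <;> ring
      · rw [e.2, if_neg e']
        split_ifs <;> ring
  have hg' : ElemCost T (SpShortcut.elem t s (-1) * SpShortcut.elem s t 1 * g)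
      (cost (-1) + cost 1 + c) :=
    ((ElemCost.elem ht hs hst.symm _).mul (.elem hs ht hst _)).mul hg
  have hcost : cost (-1) + cost 1 = 2 := by simp [cost]
  have e : SpShortcut.elem t s (-1) * SpShortcut.elem s t 1 * g * M =
      SpShortcut.elem t s (-1) * (SpShortcut.elem s t 1 * N) := by simp only [hN, mul_assoc]
  refine ⟨_, hg'.mono (by omega), h M _ hM (hg'.mem_spBlock hT) ?_ ?_⟩
  · rw [e, hN2]
    simp [hst.symm]
  · intro a h1 h2
    rw [e, hN2]
    simp [h1, h2, ha a h1 h2]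

/-! ### Reduction of a symplectic matrix to the identity -/

variable {T : Finset (HalfRoot p)} {t : HalfRoot p}

theorem mem_sameSign {a : HalfRoot p} : a ∈ sameSign T t ↔ a ∈ T ∧ sgn a = sgn t := by
  simp [sameSign]

theorem hneg_ne_of_sgn_eq {a b : HalfRoot p} (h : sgn a = sgn b) : hneg a ≠ b := by
  rcases a with i | i <;> rcases b with j | j <;> simp_all [sgn, hneg]

theorem sgn_eq_or (a b : HalfRoot p) : sgn a = sgn b ∨ sgn (hneg a) = sgn b := by
  rcases a with i | i <;> rcases b with j | j <;> simp [sgn, hneg]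

/-- Reduce column `t` to a multiple of `z_t`. -/
theorem reduces_column_off_diagonal (hT : IsSymplectic T) (ht : t ∈ T) :
    Reduces T (fun M => M ∈ spBlock T) (fun M => M ∈ spBlock T ∧ ∀ a ≠ t, M.1 a t = 0) := by
  set U := sameSign T t with hU
  have h1 : Reduces T (fun M => M ∈ spBlock T)
      (fun M => M ∈ spBlock T ∧ ∀ a ∈ U, M.1 (hneg a) t = 0) := by
    refine Reduces.forall_mem (fun a M => M.1 (hneg a) t = 0) fun V hV s hs => ?_
    obtain ⟨hsT, hss⟩ := mem_sameSign.1 hs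
    refine reduces_euclid (b := t) hT hsT (hT s hsT) (hneg_ne s).symm (fun M _ => Or.inl rfl) ?_
    intro M g hM hg hz ha
    refine ⟨⟨mul_mem_spBlock hg hM.1, fun a haV => ?_⟩, hz⟩
    by_cases e : a = s
    · exact e ▸ hz
    · rw [ha _ (hneg_ne_of_sgn_eq (((mem_sameSign.1 (hV haV)).2).trans hss.symm))
        (fun h => e (hneg_injective h))]
      exact hM.2 a haV
  refine h1.trans ((Reduces.forall_mem (U := U.erase t) (fun a M => M.1 a t = 0)
    fun V hV s hs => ?_).trans (Reduces.of_imp ?_))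
  · obtain ⟨hst, hsU⟩ := Finset.mem_erase.1 hs
    obtain ⟨hsT, hss⟩ := mem_sameSign.1 hsU
    refine reduces_euclid (b := t) hT ht hsT hst.symm (fun M hM => Or.inr
      ⟨hM.1.2 t (mem_sameSign.2 ⟨ht, rfl⟩), hM.1.2 s hsU⟩) ?_
    intro M g hM hg hz ha
    refine ⟨⟨⟨mul_mem_spBlock hg hM.1.1, fun a haU => ?_⟩, fun a haV => ?_⟩, hz⟩
    · have has := (mem_sameSign.1 haU).2
      rw [ha _ (hneg_ne_of_sgn_eq has) (hneg_ne_of_sgn_eq (has.trans hss.symm))]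
      exact hM.1.2 a haU
    · by_cases e : a = s
      · exact e ▸ hz
      · rw [ha a (Finset.mem_erase.1 (hV haV)).1 e]
        exact hM.2 a haV
  · rintro M ⟨⟨hM, hneg0⟩, hpos0⟩
    refine ⟨hM, fun a hat => ?_⟩
    by_cases haT : a ∈ T
    · rcases sgn_eq_or a t with h | h
      · exact hpos0 a (Finset.mem_erase.2 ⟨hat, mem_sameSign.2 ⟨haT, h⟩⟩)
      · have := hneg0 (hneg a) (mem_sameSign.2 ⟨hT a haT, h⟩)
        rwa [hneg_hneg] at this
    · exact (mem_spBlock_iff.1 hM).1 t ht a haT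

theorem diagonal_mul_self_eq_one {M : Sp p ℤ} (h : ∀ a ≠ t, M.1 a t = 0) :
    M.1 t t * M.1 t t = 1 := by
  have h1 : ((M⁻¹ * M : Sp p ℤ).1 : Matrix (HalfRoot p) (HalfRoot p) ℤ) t t = 1 := by
    rw [inv_mul_cancel]
    exact Matrix.one_apply_eq t
  rw [Submonoid.coe_mul, Matrix.mul_apply,
    Finset.sum_eq_single t (fun a _ ha => by rw [h a ha, mul_zero]) (by simp)] at h1
  exact Int.isUnit_mul_self (IsUnit.of_mul_eq_one_right _ h1)

theorem elem_hneg_mul_apply (x : ℤ) (M : Sp p ℤ) (a b : HalfRoot p) :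
    (elem t (hneg t) x * M).1 a b = M.1 a b + if a = t then x * M.1 (hneg t) b else 0 := by
  rw [elem_mul_apply (hneg_ne t).symm, if_neg (fun h : hneg t ≠ hneg t ∧ _ => h.1 rfl), add_zero]

theorem elem_hneg_mul_apply' (x : ℤ) (M : Sp p ℤ) (a b : HalfRoot p) :
    (elem (hneg t) t x * M).1 a b = M.1 a b + if a = hneg t then x * M.1 t b else 0 := by
  rw [elem_mul_apply (hneg_ne t),
    if_neg (fun h : t ≠ hneg (hneg t) ∧ _ => h.1 (hneg_hneg t).symm), add_zero]

/-- Reduce column `t` to `z_t`. If the column is `c z_t` with `c = ±1`, then the entries at `t` and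
`-t` change as `(c, 0) → (c, 1 - c) → (1, 1 - c) → (1, 0)`. -/
theorem reduces_column (hT : IsSymplectic T) (ht : t ∈ T) :
    Reduces T (fun M => M ∈ spBlock T)
      (fun M => M ∈ spBlock T ∧ ∀ a, M.1 a t = (1 : Matrix (HalfRoot p) (HalfRoot p) ℤ) a t) := by
  have ht' := hT t ht
  have hne := hneg_ne t
  have hb : ∀ (M : Sp p ℤ) (a b : HalfRoot p), ((M.1 a b).natAbs : ℝ) ≤ ‖M.1‖ :=
    fun M => natAbs_apply_le_norm M.1
  refine (reduces_column_off_diagonal hT ht).trans (.trans (Q := fun M => M ∈ spBlock T ∧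
    (∀ a ≠ t, a ≠ hneg t → M.1 a t = 0) ∧ M.1 t t + M.1 (hneg t) t = 1) ?_ (.trans (Q := fun M =>
    M ∈ spBlock T ∧ (∀ a ≠ t, a ≠ hneg t → M.1 a t = 0) ∧ M.1 t t = 1) ?_ ?_))
  · refine Reduces.elem ht' ht hne (fun M => M.1 t t - 1) (fun M => ?_) ?_
    · have h1 := hb M t t
      have h2 : (M.1 t t - 1).natAbs ≤ (M.1 t t).natAbs + 1 := by omega
      have h3 : ((M.1 t t - 1).natAbs : ℝ) ≤ (M.1 t t).natAbs + 1 := by exact_mod_cast h2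
      linarith
    · rintro M ⟨hM, hz⟩
      refine ⟨mul_mem_spBlock (elem_mem_spBlock hT ht' ht hne _) hM, fun a h1 h2 => ?_, ?_⟩
      · rw [elem_hneg_mul_apply', if_neg h2, hz a h1, add_zero]
      · rw [elem_hneg_mul_apply', elem_hneg_mul_apply', if_neg hne.symm, if_pos rfl, hz _ hne]
        linear_combination diagonal_mul_self_eq_one hz
  · refine Reduces.elem ht ht' hne.symm (fun _ => 1) (fun M => ?_) ?_
    · have := norm_nonneg M.1
      simp only [Int.natAbs_one, Nat.cast_one]
      linarith
    · rintro M ⟨hM, hz, h1⟩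
      refine ⟨mul_mem_spBlock (elem_mem_spBlock hT ht ht' hne.symm _) hM, fun a h2 h3 => ?_, ?_⟩
      · rw [elem_hneg_mul_apply, if_neg h2, hz a h2 h3, add_zero]
      · rw [elem_hneg_mul_apply, if_pos rfl, one_mul, h1]
  · refine Reduces.elem ht' ht hne (fun M => -M.1 (hneg t) t) (fun M => ?_) ?_
    · have := hb M (hneg t) t
      rw [Int.natAbs_neg]
      linarith
    · rintro M ⟨hM, hz, h1⟩
      refine ⟨mul_mem_spBlock (elem_mem_spBlock hT ht' ht hne _) hM, fun a => ?_⟩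
      rw [elem_hneg_mul_apply', h1, Matrix.one_apply]
      by_cases e : a = hneg t
      · rw [if_pos e, if_neg (e ▸ hne), e]
        ring
      · by_cases e' : a = t
        · rw [if_neg e, if_pos e', e', h1, add_zero]
        · rw [if_neg e, if_neg e', hz a e' e, add_zero]

/-- Reduce `Sp(T)` to `Sp(T ∖ {±t})`. Once column `t` is `z_t`, row `-t` is that of the identity,
so the entry `-t` of column `-t` is a pivot that clears this column. -/
theorem reduces_spBlock_erase (hT : IsSymplectic T) (ht : t ∈ T) :
    Reduces T (fun M => M ∈ spBlock T) (fun M => M ∈ spBlock ((T.erase t).erase (hneg t))) := by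
  have ht' := hT t ht
  have hne := hneg_ne t
  have hb : ∀ (M : Sp p ℤ) (a b : HalfRoot p), ((-M.1 a b).natAbs : ℝ) ≤ ‖M.1‖ + 2 := by
    intro M a b
    have := natAbs_apply_le_norm M.1 a b
    rw [Int.natAbs_neg]
    linarith
  set U := (T.erase t).erase (hneg t) with hU
  -- Multiplication by `e_{s+t}(x)` preserves `M z_t = z_t`.
  have hcol : ∀ s, s ≠ hneg t → ∀ (x : ℤ) (M : Sp p ℤ),
      (∀ a, M.1 a t = (1 : Matrix (HalfRoot p) (HalfRoot p) ℤ) a t) → ∀ a,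
        (elem s (hneg t) x * M).1 a t = (1 : Matrix (HalfRoot p) (HalfRoot p) ℤ) a t := by
    intro s hs x M hM a
    have hs' : hneg s ≠ t := fun e => hs (hneg_eq_iff.1 e)
    rw [elem_mul_apply hs, hM, hM, hM, Matrix.one_apply_ne hne, Matrix.one_apply_ne hs', mul_zero,
      mul_zero, ite_self, ite_self, add_zero, add_zero]
  refine (reduces_column hT ht).trans ((Reduces.forall_mem (U := U)
    (fun a M => M.1 a (hneg t) = 0) fun V hV s hs => ?_).trans (.trans (Q := fun M =>
      (M ∈ spBlock T ∧ ∀ a, M.1 a t = (1 : Matrix (HalfRoot p) (HalfRoot p) ℤ) a t) ∧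
      ∀ a, M.1 a (hneg t) = (1 : Matrix (HalfRoot p) (HalfRoot p) ℤ) a (hneg t)) ?_
      (Reduces.of_imp ?_)))
  · obtain ⟨hs1, hs2⟩ := Finset.mem_erase.1 hs
    obtain ⟨hs2, hs3⟩ := Finset.mem_erase.1 hs2
    refine Reduces.elem hs3 ht' hs1 (fun M => -M.1 s (hneg t)) (fun M => hb M _ _) ?_
    rintro M ⟨⟨hM, hMt⟩, hV0⟩
    have hrow : M.1 (hneg t) (hneg t) = 1 := by
      rw [row_hneg_of_col hMt, Matrix.one_apply_eq]
    have key : ∀ a ≠ t, (elem s (hneg t) (-M.1 s (hneg t)) * M).1 a (hneg t) =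
        M.1 a (hneg t) - if a = s then M.1 s (hneg t) else 0 := by
      intro a ha
      rw [elem_mul_apply hs1, hrow,
        if_neg (fun h : _ ∧ a = hneg (hneg t) => ha (h.2.trans (hneg_hneg t)))]
      split_ifs <;> ring
    refine ⟨⟨⟨mul_mem_spBlock (elem_mem_spBlock hT hs3 ht' hs1 _) hM, hcol s hs1 _ M hMt⟩,
      fun a ha => ?_⟩, ?_⟩
    · rw [key a (Finset.mem_erase.1 (Finset.mem_erase.1 (hV ha)).2).1, hV0 a ha]
      split_ifs with e
      · rw [← e, hV0 a ha, sub_zero]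
      · rw [sub_zero]
    · rw [key s hs2, if_pos rfl, sub_self]
  · refine Reduces.elem ht ht' hne.symm (fun M => -M.1 t (hneg t)) (fun M => hb M _ _) ?_
    rintro M ⟨⟨hM, hMt⟩, hU0⟩
    have hrow : M.1 (hneg t) (hneg t) = 1 := by
      rw [row_hneg_of_col hMt, Matrix.one_apply_eq]
    refine ⟨⟨mul_mem_spBlock (elem_mem_spBlock hT ht ht' hne.symm _) hM,
      hcol t hne.symm _ M hMt⟩, fun a => ?_⟩
    rw [elem_hneg_mul_apply, hrow]
    by_cases e : a = t
    · rw [if_pos e, e, Matrix.one_apply_ne hne.symm]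
      ring
    · rw [if_neg e, add_zero]
      by_cases e' : a = hneg t
      · rw [e', hrow, Matrix.one_apply_eq]
      · rw [Matrix.one_apply_ne e']
        by_cases haT : a ∈ T
        · exact hU0 a (Finset.mem_erase.2 ⟨e', Finset.mem_erase.2 ⟨e, haT⟩⟩)
        · exact (mem_spBlock_iff.1 hM).1 _ ht' a haT
  · rintro M ⟨⟨hM, hMt⟩, hMt'⟩
    have hr1 := row_hneg_of_col hMt
    have hr2 := row_hneg_of_col hMt'
    rw [hneg_hneg] at hr2
    rw [mem_spBlock_iff] at hM ⊢
    refine ⟨fun b hb a ha => ?_, fun b hb a => ?_⟩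
    · obtain ⟨hb1, hb2⟩ := Finset.mem_erase.1 hb
      obtain ⟨hb2, hb3⟩ := Finset.mem_erase.1 hb2
      by_cases e : a = hneg t
      · rw [e, hr1, Matrix.one_apply_ne hb1.symm]
      · by_cases e' : a = t
        · rw [e', hr2, Matrix.one_apply_ne hb2.symm]
        · exact hM.1 b hb3 a fun h => ha (Finset.mem_erase.2 ⟨e, Finset.mem_erase.2 ⟨e', h⟩⟩)
    · by_cases e : b = hneg t
      · rw [e, hMt']
      · by_cases e' : b = t
        · rw [e', hMt]
        · exact hM.2 b (fun h => hb (Finset.mem_erase.2 ⟨e, Finset.mem_erase.2 ⟨e', h⟩⟩)) a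

theorem reduces_one (T : Finset (HalfRoot p)) (hT : IsSymplectic T) :
    Reduces T (fun M => M ∈ spBlock T) (fun M => M = 1) := by
  induction T using Finset.strongInduction with
  | H T ih =>
  rcases T.eq_empty_or_nonempty with rfl | ⟨t, ht⟩
  · refine Reduces.of_imp fun M hM => ?_
    apply Subtype.ext
    ext a b
    exact (mem_spBlock_iff.1 hM).2 b (Finset.notMem_empty b) a
  · have hU : (T.erase t).erase (hneg t) ⊂ T :=
      (Finset.erase_subset _ _).trans_ssubset (Finset.erase_ssubset ht)
    refine (reduces_spBlock_erase hT ht).trans ((ih _ hU ?_).subset hU.1)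
    intro a ha
    simp only [Finset.mem_erase] at ha ⊢
    exact ⟨fun h => ha.2.1 (hneg_injective h), fun h => ha.1 (hneg_eq_iff.1 h), hT a ha.2.2⟩

/-- A matrix in `Sp(T; ℤ)` of norm at most `2 ^ m` is a product of elementary matrices with roots
in `Sp(T)` whose cost is linear in `m`. -/
theorem exists_elemCost_of_norm_le (p : ℕ) : ∃ K : ℕ, ∀ T : Finset (HalfRoot p), IsSymplectic T →
    ∀ m, 1 ≤ m → ∀ M ∈ spBlock T, ‖M.1‖ ≤ 2 ^ m → ElemCost T M (K * m) := by
  have h : ∀ T : Finset (HalfRoot p), ∃ K : ℕ, IsSymplectic T →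
      ∀ m, 1 ≤ m → ∀ M ∈ spBlock T, ‖M.1‖ ≤ 2 ^ m → ElemCost T M (K * m) := by
    intro T
    by_cases hT : IsSymplectic T
    · obtain ⟨K, hK⟩ := reduces_one T hT
      refine ⟨K, fun _ m hm M hM hn => ?_⟩
      obtain ⟨g, hg, e⟩ := hK m hm M hM hn
      rw [eq_inv_of_mul_eq_one_right e]
      exact hg.inv
    · exact ⟨0, fun h => absurd h hT⟩
  choose K hK using h
  obtain ⟨N, hN⟩ := Finite.exists_le K
  exact ⟨N, fun T hT m hm M hM hn =>
    (hK T hT m hm M hM hn).mono (Nat.mul_le_mul_right m (hN T))⟩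

/-- The norm of the matrix represented by a nonempty word is exponential in its length. -/
theorem exists_norm_prod_le {A : Set (Sp p ℤ)} (hA : A.Finite) : ∃ r : ℕ, ∀ w : List (Sp p ℤ),
    (∀ g ∈ w, g ∈ A) → ‖w.prod.1‖ ≤ 2 ^ (r * w.length) := by
  obtain ⟨R, hR⟩ := (hA.image fun g : Sp p ℤ => ‖g.1‖).bddAbove
  obtain ⟨r, hr⟩ := exists_nat_ge R
  have hr' : R ≤ 2 ^ r := by
    have h : (r : ℝ) ≤ 2 ^ r := by exact_mod_cast Nat.lt_two_pow_self.le
    exact hr.trans h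
  refine ⟨r, fun w => ?_⟩
  induction w with
  | nil => exact fun _ => by simpa using norm_one_le
  | cons g w ih =>
    intro hw
    have h1 := hR ⟨g, hw g (List.mem_cons_self ..), rfl⟩
    have h2 := ih fun a ha => hw a (List.mem_cons_of_mem _ ha)
    rw [List.prod_cons, Submonoid.coe_mul, List.length_cons, mul_add_one, add_comm, pow_add]
    exact (norm_mul_le _ _).trans (mul_le_mul (h1.trans hr') h2 (norm_nonneg _) (by positivity))

/-! ### Lengths of the shortcuts -/

theorem length_powWord (d : ℝ → Sp p ℝ) (y : ℝ) : (powWord d y).length = ⌈|y|⌉₊ := by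
  simp [powWord]

theorem log_one_add_natAbs_le (x : ℤ) : Real.log (1 + |(x : ℝ)|) ≤ cost x := by
  have h1 : (1 + |(x : ℝ)|) ≤ 2 ^ cost x := by
    rw [← Int.cast_abs, Int.abs_eq_natAbs, Int.cast_natCast]
    exact_mod_cast one_add_natAbs_le_two_pow_cost x
  calc Real.log (1 + |(x : ℝ)|) ≤ Real.log (2 ^ cost x) := Real.log_le_log (by positivity) h1
    _ = cost x * Real.log 2 := Real.log_pow _ _
    _ ≤ cost x := mul_le_of_le_one_right (Nat.cast_nonneg _) (by linarith [Real.log_two_lt_d9])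

theorem length_uHat_le (d : ℝ → Sp p ℝ) (v w : HalfRoot p → ℝ) (c : ℝ) (x : ℤ) :
    (uHat d v w (x * c)).length ≤ (1 + 2 * (1 + ⌈Real.log (1 + |c|)⌉₊)) * cost x := by
  have hx := one_le_cost x
  unfold uHat
  by_cases h : |x * c| ≤ 1
  · rw [if_pos h]
    exact Nat.mul_pos (by omega) hx
  · rw [if_neg h]
    simp only [List.length_append, length_powWord, abs_neg, List.length_singleton]
    have hpos : 0 < Real.log |x * c| := Real.log_pos (not_le.1 h)
    have hle : Real.log |x * c| ≤ Real.log (1 + |(x : ℝ)|) + Real.log (1 + |c|) := by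
      rw [← Real.log_mul (by positivity) (by positivity)]
      refine Real.log_le_log (by linarith) ?_
      rw [abs_mul]
      nlinarith [abs_nonneg (x : ℝ), abs_nonneg c]
    have hceil : ⌈abs (Real.log |x * c|)⌉₊ ≤ cost x + ⌈Real.log (1 + |c|)⌉₊ := by
      rw [abs_of_pos hpos, Nat.ceil_le, Nat.cast_add]
      exact hle.trans (add_le_add (log_one_add_natAbs_le x) (Nat.le_ceil _))
    nlinarith

theorem exists_length_uHatWord_le (D : TorusData p) : ∃ K : ℕ, ∀ (S S' : Finset (HalfRoot p))
    (s : S) (t : S') (x : ℤ), (D.uHatWord S S' s t x).length ≤ K * cost x := by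
  have h : ∀ q : (Σ SS : Finset (HalfRoot p) × Finset (HalfRoot p), SS.1 × SS.2), ∃ K : ℕ,
      ∀ x : ℤ, (D.uHatWord q.1.1 q.1.2 q.2.1 q.2.2 x).length ≤ K * cost x := by
    rintro ⟨⟨S, S'⟩, s, t⟩
    refine ⟨((Finset.univ : Finset (S × S')).toList.map fun ij => 1 + 2 * (1 + ⌈Real.log (1 +
      |(D.v S).repr (Pi.single s 1) ij.1 * (D.v S').repr (Pi.single t 1) ij.2|)⌉₊)).sum,
      fun x => ?_⟩
    rw [TorusData.uHatWord, List.length_flatMap, ← List.sum_map_mul_right]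
    refine List.sum_le_sum fun ij _ => ?_
    rw [mul_assoc]
    exact length_uHat_le _ _ _ _ x
  choose K hK using h
  obtain ⟨N, hN⟩ := Finite.exists_le K
  exact ⟨N, fun S S' s t x =>
    (hK ⟨(S, S'), s, t⟩ x).trans (Nat.mul_le_mul_right _ (hN _))⟩

theorem IsApproximation.length_eq {A : Set (Sp p ℤ)} {H : Subgroup (Sp p ℤ)} {C : ℝ}
    {W : List (Matrix (HalfRoot p) (HalfRoot p) ℝ)} {w : List (Sp p ℤ)}
    (h : IsApproximation A H C W w) : w.length = W.length := by
  obtain ⟨γ, -, -, -, rfl, -⟩ := h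
  simp

theorem LongCompatible.compatible {s t r : HalfRoot p} {S T : Finset (HalfRoot p)}
    (h : LongCompatible s S T t) (hr : r ∈ T) : Compatible s r S (sameSign T r) := by
  obtain ⟨hs, -, hd, hS, hT, hS2, -⟩ := h
  have hrr : r ∈ sameSign T r := mem_sameSign.2 ⟨hr, rfl⟩
  refine ⟨hs, hrr, Finset.disjoint_of_subset_right (Finset.filter_subset _ _) hd, ?_, hS2,
    Finset.card_pos.2 ⟨r, hrr⟩⟩
  intro a ha ha'
  rcases Finset.mem_union.1 ha with h1 | h1 <;> rcases Finset.mem_union.1 ha' with h2 | h2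
  · exact hS a h1 h2
  · have h3 := hT _ (mem_sameSign.1 h2).1
    rw [hneg_hneg] at h3
    exact Finset.disjoint_left.1 hd h1 h3
  · exact Finset.disjoint_left.1 hd h2 (hT _ (mem_sameSign.1 h1).1)
  · exact hneg_ne_of_sgn_eq ((mem_sameSign.1 h1).2.trans (mem_sameSign.1 h2).2.symm) rfl

theorem cost_mono {x y : ℤ} (h : x.natAbs ≤ y.natAbs) : cost x ≤ cost y :=
  Nat.add_le_add_left (Nat.log_mono_right h) 1

/-- The half roots of a root are unique up to replacing `s - t` by `-t - (-s)`. -/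
theorem eq_or_eq_hneg_of_hvec_sub_eq {s t s' t' : HalfRoot p} (h : s ≠ t)
    (e : hvec s - hvec t = hvec s' - hvec t') :
    s' = s ∧ t' = t ∨ s' = hneg t ∧ t' = hneg s := by
  have key := fun i => congrFun e i
  rcases s with i | i <;> rcases t with j | j <;> rcases s' with k | k <;> rcases t' with l | l <;>
    (have h1 := key i
     have h2 := key j
     have h3 := key k
     have h4 := key l
     simp only [hvec, hneg, Sum.elim_inl, Sum.elim_inr, Sum.swap_inl, Sum.swap_inr, Pi.sub_apply,
       Pi.neg_apply, Pi.single_apply] at *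
     grind)

theorem hvec_injective : Function.Injective (hvec : HalfRoot p → Fin p → ℤ) := by
  intro s t e
  rcases s with i | i <;> rcases t with j | j <;>
    (have h1 := congrFun e i
     have h2 := congrFun e j
     simp only [hvec, Sum.elim_inl, Sum.elim_inr, Pi.neg_apply, Pi.single_apply] at *
     grind)

namespace ShortcutSystem

variable {A : Set (Sp p ℤ)}

/-- Shortcuts have length `O(1 + log |x|)`. -/
theorem exists_length_shortcut_le (E : ShortcutSystem p A) : ∃ K : ℕ, ∀ α ∈ roots p, ∀ x : ℤ,
    (E.shortcut α x).length ≤ K * cost x := by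
  obtain ⟨K, hK⟩ := exists_length_uHatWord_le E.toTorusData
  have hshort : ∀ s t S S', Compatible s t S S' → ∀ x : ℤ,
      (E.short s t S S' x).length ≤ K * cost x := by
    intro s t S S' h x
    rw [(E.short_spec s t S S' h x).length_eq]
    exact hK S S' _ _ x
  refine ⟨4 * K + 1, fun α hα x => ?_⟩
  have hx := one_le_cost x
  unfold shortcut
  split_ifs with hl
  · have hc := E.longCompatible (E.head α)
    generalize E.head α = s at *
    have h1 := hshort _ _ _ _ (hc.compatible hc.2.1) (sgn s * sgn (E.longt s) * (x / 2))
    have h2 := hshort _ _ _ _ (hc.compatible (hc.2.2.2.2.1 _ hc.2.1)) 1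
    have h3 : cost (sgn s * sgn (E.longt s) * (x / 2)) ≤ cost x := by
      apply cost_mono
      have h4 : ∀ r : HalfRoot p, (sgn r).natAbs = 1 := by
        rintro (i | i) <;> rfl
      rw [Int.natAbs_mul, Int.natAbs_mul, h4, h4]
      omega
    have h4 : cost 1 ≤ cost x := by simp [cost]
    have h5 := Nat.mul_le_mul_left K h3
    have h6 := Nat.mul_le_mul_left K h4
    have h7 : (if x % 2 = 1 then [elem s (hneg s) 1] else []).length ≤ 1 := by
      split_ifs <;> simp
    simp only [long, commWord, invWord, List.length_append, List.length_reverse, List.length_map]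
    nlinarith
  · have := hshort _ _ _ _ (E.compatible α hα hl) x
    nlinarith

/-- Every elementary matrix is an `e_α(x)`, whichever way of writing `α` has been fixed. -/
theorem exists_e_eq_elem (E : ShortcutSystem p A) {T : Finset (HalfRoot p)} {s t : HalfRoot p}
    (hs : s ∈ T) (ht : t ∈ T) (h : s ≠ t) (x : ℤ) :
    ∃ α ∈ spRoots T, ∃ y : ℤ, cost y = cost x ∧ E.e α y = elem s t x := by
  have hα : hvec s - hvec t ≠ 0 := fun e => h (hvec_injective (sub_eq_zero.1 e))
  refine ⟨hvec s - hvec t, ⟨hα, s, hs, t, ht, rfl⟩, ?_⟩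
  have hr : hvec s - hvec t ∈ roots p := ⟨hα, s, Finset.mem_univ s, t, Finset.mem_univ t, rfl⟩
  unfold e
  rcases eq_or_eq_hneg_of_hvec_sub_eq h (E.head_sub_tail _ hr) with ⟨h1, h2⟩ | ⟨h1, h2⟩
  · exact ⟨x, rfl, by rw [h1, h2]⟩
  · rw [h1, h2]
    by_cases e : t = hneg s
    · exact ⟨x, rfl, by rw [e, hneg_hneg]⟩
    · refine ⟨_, ?_, elem_hneg_hneg e x⟩
      rw [cost_neg]
      rcases s with i | i <;> rcases t with j | j <;> simp [sgn, cost_neg]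

theorem exists_list_of_elemCost (E : ShortcutSystem p A) {T : Finset (HalfRoot p)} {g : Sp p ℤ}
    {c : ℕ} (h : ElemCost T g c) : ∃ L : List ((Fin p → ℤ) × ℤ), (∀ a ∈ L, a.1 ∈ spRoots T) ∧
      (L.map fun a => E.e a.1 a.2).prod = g ∧ (L.map fun a => cost a.2).sum ≤ c := by
  induction h with
  | one => exact ⟨[], by simp, by simp, by simp⟩
  | elem hs ht h x =>
    obtain ⟨α, hα, y, hy, e⟩ := E.exists_e_eq_elem hs ht h x
    exact ⟨[(α, y)], by simpa using hα, by simpa using e, by simp [hy]⟩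
  | mul _ _ h1 h2 =>
    obtain ⟨L, hL, e, hc⟩ := h1
    obtain ⟨L', hL', e', hc'⟩ := h2
    refine ⟨L ++ L', fun a ha => (List.mem_append.1 ha).elim (hL a) (hL' a), ?_, ?_⟩
    · rw [List.map_append, List.prod_append, e, e']
    · rw [List.map_append, List.sum_append]
      omega
  | mono _ hcd h1 =>
    obtain ⟨L, hL, e, hc⟩ := h1
    exact ⟨L, hL, e, hc.trans hcd⟩

end ShortcutSystem

end SpShortcut

theorem theorem4p8 (p : ℕ) (hp : 3 ≤ p) (A : Set (SpShortcut.Sp p ℤ))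
    (hA : SpShortcut.IsGeneratingSet A) (E : SpShortcut.ShortcutSystem p A) :
    ∃ K : ℕ, ∀ T : Finset (SpShortcut.HalfRoot p), SpShortcut.IsSymplectic T →
      ∀ w : List (SpShortcut.Sp p ℤ), (∀ g ∈ w, g ∈ A) → w.prod ∈ SpShortcut.spBlock T →
        ∃ L : List ((Fin p → ℤ) × ℤ),
          (∀ a ∈ L, a.1 ∈ SpShortcut.spRoots T) ∧
          (L.map fun a => E.e a.1 a.2).prod = w.prod ∧
          ((L.map fun a => E.shortcut a.1 a.2).flatten).length ≤ K * w.length := by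
  obtain ⟨r, hr⟩ := SpShortcut.exists_norm_prod_le hA.finite
  obtain ⟨K, hK⟩ := SpShortcut.exists_elemCost_of_norm_le p
  obtain ⟨N, hN⟩ := E.exists_length_shortcut_le
  refine ⟨N * (K * (r + 1)), fun T hT w hw hM => ?_⟩
  rcases w.eq_nil_or_concat with rfl | hne
  · exact ⟨[], by simp, by simp, by simp⟩
  have hlen : 1 ≤ w.length := by
    obtain ⟨l, a, rfl⟩ := hne
    simp
  have h1 := hK T hT ((r + 1) * w.length) (Nat.mul_pos r.succ_pos hlen) _ hM
    ((hr w hw).trans (pow_le_pow_right₀ (by norm_num) (Nat.mul_le_mul_right _ r.le_succ)))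
  obtain ⟨L, hL, e, hc⟩ := E.exists_list_of_elemCost h1
  refine ⟨L, hL, e, ?_⟩
  have hroots : ∀ a ∈ L, a.1 ∈ SpShortcut.roots p := by
    intro a ha
    obtain ⟨h0, s, -, t, -, h⟩ := hL a ha
    exact ⟨h0, s, Finset.mem_univ s, t, Finset.mem_univ t, h⟩
  rw [List.length_flatten, List.map_map]
  calc (L.map (List.length ∘ fun a => E.shortcut a.1 a.2)).sum
      ≤ (L.map fun a => N * SpShortcut.cost a.2).sum :=
        List.sum_le_sum fun a ha => hN a.1 (hroots a ha) a.2
    _ = N * (L.map fun a => SpShortcut.cost a.2).sum := List.sum_map_mul_left _ _ _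
    _ ≤ N * (K * ((r + 1) * w.length)) := Nat.mul_le_mul_left N hc
    _ = N * (K * (r + 1)) * w.length := by ring
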